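/- Let $q\in\mathbb{C}$ with $|q|<1$. Then the series below converges absolutely, the continued fraction below converges to a finite value, and $$1-\sum_{n=1}^{\infty} q^{n(3n-1)/2}(1-q^{n}) =\cfrac{2}{2+q+\cfrac{q-q^{3}}{1+q^{3}+\cfrac{q^{2}+q^{3}}{1+q^{5}+\cfrac{q^{5}-q^{9}}{1+q^{7}+\cfrac{q^{4}+q^{7}}{1+q^{9}+\cfrac{q^{9}-q^{15}}{1+q^{11}+\cfrac{q^{6}+q^{11}}{1+q^{13}+\cdots}}}}}}}.$$ Here the continued fraction is $\cfrac{a_1}{b_1+\cfrac{a_2}{b_2+\cfrac{a_3}{b_3+\cdots}}}$ with $a_1=2$, $b_1=2+q$, and, for every $j\ge 0$, $$a_{2j+2}=q^{4j+1}-q^{6j+3},\qquad b_{2j+2}=1+q^{4j+3},\qquad a_{2j+3}=q^{2j+2}+q^{4j+3},\qquad b_{2j+3}=1+q^{4j+5}.$$ Its value is the limit of its approximants $A_n/B_n$, where $A_{-1}=1$, $A_0=0$, $B_{-1}=0$, $B_0=1$ and $A_n=b_nA_{n-1}+a_nA_{n-2}$, $B_n=b_nB_{n-1}+a_nB_{n-2}$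 for $n\ge1$; part of the claim is that $B_n\neq0$ for all sufficiently large $n$. -/

import Mathlib

open Filter Topology

/-- The continued fraction `g` converges to the finite value `f`: its approximants `Aₙ / Bₙ`,
which are points of the Riemann sphere `ℂ ∪ {∞}`, tend to `f`. An approximant with `Bₙ = 0`
is the point `∞`, which cannot occur for large `n` when the limit is finite. -/
def ContFracConvergesTo (g : GenContFract ℂ) (f : ℂ) : Prop :=
  (∀ᶠ n in atTop, g.dens n ≠ 0) ∧ Tendsto g.convs atTop (𝓝 f)

/-- Partial numerators of the continued fraction, from the first one on:
`2, q - q³, q² + q³, q⁵ - q⁹, q⁴ + q⁷, q⁹ - q¹⁵, q⁶ + q¹¹, …`. -/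
def partialNum (q : ℂ) : ℕ → ℂ
  | 0 => 2
  | n + 1 =>
    if Even n then q ^ (4 * (n / 2) + 1) - q ^ (6 * (n / 2) + 3)
    else q ^ (2 * (n / 2) + 2) + q ^ (4 * (n / 2) + 3)

/-- Partial denominators of the continued fraction, from the first one on:
`2 + q, 1 + q³, 1 + q⁵, 1 + q⁷, …`. -/
def partialDen (q : ℂ) : ℕ → ℂ
  | 0 => 2 + q
  | n + 1 => 1 + q ^ (2 * n + 3)

/-- The continued fraction `2/(2+q) + (q-q³)/(1+q³) + (q²+q³)/(1+q⁵) + (q⁵-q⁹)/(1+q⁷) + ⋯`,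
each fraction after the first being added in the denominator of the one before it. -/
def qContFrac (q : ℂ) : GenContFract ℂ where
  h := 0
  s := Stream'.Seq.ofStream fun n => ⟨partialNum q n, partialDen q n⟩

/-! The continued fraction is evaluated by a Pincherle-type argument. If `V` is bounded with `V n =
b n * V (n + 1) + a (n + 1) * V (n + 2)` and `V 0 = 1`, then `V (n + 1) * x (n + 1) + a (n + 1) * V
(n + 2) * x n` is constant in `n` for the numerators and denominators `x`. These stay bounded and
`a` tends to 0, so `V n * x n` converges: to 1 for denominators, to `a 0 * V 1` for numerators
(`contFracConvergesTo_of_bounded_tails`).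

Here `V` is `tailSolution`, built from basic hypergeometric series whose contiguous relations give
the recurrence. Its value `2 * V 1` is Fine's series `∑ (-q)ⁿ / (-q²; q²)ₙ`.

This series equals Rogers' `∑ (-1)ⁿ q^(n(n+1)/2) / (-q; q)ₙ`, which equals the false theta series, a
regrouping of the stated sum. For both equalities, each side is put in a family indexed by `k`; the
two families satisfy the same first-order recurrence with vanishing multiplier, whose bounded
solution is unique (`eq_of_bounded_of_backward_recurrence`). -/

/-! ### Boundedness, convergence and uniqueness for linear recurrences. -/

/-- Solutions of a three-term recurrence whose coefficients are summably close to `(1, 0)` are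
bounded. -/
theorem exists_norm_le_of_recurrence {a b x : ℕ → ℂ} (ha : Summable fun n => ‖a n‖)
    (hb : Summable fun n => ‖b n - 1‖)
    (hx : ∀ n, x (n + 2) = b n * x (n + 1) + a n * x n) : ∃ C, ∀ n, ‖x n‖ ≤ C := by
  set M := ‖x 0‖ + ‖x 1‖
  have hM : 0 ≤ M := by positivity
  have key : ∀ n, ‖x n‖ ≤ M * ∏ i ∈ Finset.range n, (1 + (‖b i - 1‖ + ‖a i‖)) ∧
      ‖x (n + 1)‖ ≤ M * ∏ i ∈ Finset.range n, (1 + (‖b i - 1‖ + ‖a i‖)) := by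
    intro n
    induction n with
    | zero => simp [M]
    | succ n ih =>
      obtain ⟨h0, h1⟩ := ih
      rw [Finset.prod_range_succ, ← mul_assoc]
      set K := M * ∏ i ∈ Finset.range n, (1 + (‖b i - 1‖ + ‖a i‖))
      have hK : 0 ≤ K := (norm_nonneg _).trans h0
      have hba : 0 ≤ ‖b n - 1‖ + ‖a n‖ := by positivity
      refine ⟨by nlinarith, ?_⟩
      calc ‖x (n + 2)‖ = ‖x (n + 1) + (b n - 1) * x (n + 1) + a n * x n‖ := by
            rw [hx]; ring_nf
        _ ≤ ‖x (n + 1)‖ + ‖b n - 1‖ * ‖x (n + 1)‖ + ‖a n‖ * ‖x n‖ := by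
            refine (norm_add₃_le).trans ?_
            rw [norm_mul, norm_mul]
        _ ≤ K + ‖b n - 1‖ * K + ‖a n‖ * K := by gcongr
        _ = K * (1 + (‖b n - 1‖ + ‖a n‖)) := by ring
  refine ⟨M * Real.exp (∑' i, (‖b i - 1‖ + ‖a i‖)), fun n => (key n).1.trans ?_⟩
  gcongr
  refine (Real.prod_one_add_le_exp_sum _ fun i => by positivity).trans ?_
  exact Real.exp_le_exp.2 ((hb.add ha).sum_le_tsum _ fun i _ => by positivity)

/-- A continued fraction converges to the ratio given by a bounded solution of the backward
recurrence that governs its tails. -/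
theorem contFracConvergesTo_of_bounded_tails {a b V : ℕ → ℂ} (ha : Summable fun n => ‖a n‖)
    (hb : Summable fun n => ‖b n - 1‖) (hV : ∃ C, ∀ n, ‖V n‖ ≤ C) (hV0 : V 0 = 1)
    (hrec : ∀ n, V n = b n * V (n + 1) + a (n + 1) * V (n + 2)) :
    ContFracConvergesTo ⟨0, Stream'.Seq.ofStream fun n => ⟨a n, b n⟩⟩ (a 0 * V 1) := by
  set g : GenContFract ℂ := ⟨0, Stream'.Seq.ofStream fun n => ⟨a n, b n⟩⟩ with hg
  have hs : ∀ n, g.s.get? n = some ⟨a n, b n⟩ := fun n => rfl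
  have ha' : Summable fun n => ‖a (n + 1)‖ := (summable_nat_add_iff 1).2 ha
  have hb' : Summable fun n => ‖b (n + 1) - 1‖ :=
    (summable_nat_add_iff (f := fun n => ‖b n - 1‖) 1).2 hb
  have h0 : Tendsto (fun n => a (n + 1)) atTop (𝓝 0) :=
    tendsto_zero_iff_norm_tendsto_zero.2 ha'.tendsto_atTop_zero
  obtain ⟨C, hC⟩ := hV
  have lim : ∀ (x : ℕ → ℂ) (c : ℂ), (∀ n, x (n + 2) = b (n + 1) * x (n + 1) + a (n + 1) * x n) →
      V 1 * x 1 + a 1 * V 2 * x 0 = c → Tendsto (fun n => V n * x n) atTop (𝓝 c) := by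
    intro x c hx hc
    obtain ⟨D, hD⟩ := exists_norm_le_of_recurrence ha' hb' hx
    -- The forward recurrence of `x` and the backward one of `V` are adjoint, so this pairing is
    -- conserved.
    have inv : ∀ n, V (n + 1) * x (n + 1) + a (n + 1) * V (n + 2) * x n = c := by
      intro n
      induction n with
      | zero => exact hc
      | succ n ih =>
        rw [← ih, hx, hrec (n + 1)]
        ring
    have hz : Tendsto (fun n => a (n + 1) * (V (n + 2) * x n)) atTop (𝓝 0) := by
      refine h0.zero_mul_isBoundedUnder_le ⟨C * D, ?_⟩
      refine eventually_map.2 (Eventually.of_forall fun n => ?_)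
      simp only [Function.comp, norm_mul]
      exact mul_le_mul (hC _) (hD _) (norm_nonneg _) ((norm_nonneg _).trans (hC 0))
    refine (tendsto_add_atTop_iff_nat 1).1 ?_
    have := (tendsto_const_nhds (x := c)).sub hz
    rw [sub_zero] at this
    refine this.congr fun n => ?_
    rw [← inv n]
    ring
  have hB : Tendsto (fun n => V n * g.dens n) atTop (𝓝 1) := by
    refine lim _ _ (fun n => GenContFract.dens_recurrence (hs _) rfl rfl) ?_
    rw [GenContFract.zeroth_den_eq_one, GenContFract.first_den_eq (hs 0)]
    linear_combination hV0 - hrec 0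
  have hA : Tendsto (fun n => V n * g.nums n) atTop (𝓝 (a 0 * V 1)) := by
    refine lim _ _ (fun n => GenContFract.nums_recurrence (hs _) rfl rfl) ?_
    rw [GenContFract.zeroth_num_eq_h, GenContFract.first_num_eq (hs 0)]
    simp only [hg]
    ring
  have hne : ∀ᶠ n in atTop, V n * g.dens n ≠ 0 := hB.eventually_ne one_ne_zero
  refine ⟨hne.mono fun n hn => right_ne_zero_of_mul hn, ?_⟩
  have := hA.div hB one_ne_zero
  rw [div_one] at this
  refine this.congr' (hne.mono fun n hn => ?_)
  rw [GenContFract.conv_eq_num_div_den]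
  exact mul_div_mul_left _ _ (left_ne_zero_of_mul hn)

/-- Bounded solutions of `y k = u k + c k * y (k + 1)` with `c → 0` are unique. -/
theorem eq_of_bounded_of_backward_recurrence {u c y z : ℕ → ℂ} (hc : Tendsto c atTop (𝓝 0))
    (hy : ∃ C, ∀ n, ‖y n‖ ≤ C) (hz : ∃ C, ∀ n, ‖z n‖ ≤ C)
    (hyr : ∀ k, y k = u k + c k * y (k + 1)) (hzr : ∀ k, z k = u k + c k * z (k + 1)) :
    y 0 = z 0 := by
  obtain ⟨C, hC⟩ := hy
  obtain ⟨D, hD⟩ := hz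
  have hd : ∀ k, y k - z k = c k * (y (k + 1) - z (k + 1)) := fun k => by
    rw [hyr k, hzr k]; ring
  obtain ⟨K, hK⟩ := eventually_atTop.1
    ((tendsto_zero_iff_norm_tendsto_zero.1 hc).eventually_le_const (by norm_num : (0 : ℝ) < 1 / 2))
  -- Beyond `K` each step halves the difference relative to the next one; going `n` steps out costs
  -- only the uniform bound `C + D`.
  have hb : ∀ n k, K ≤ k → ‖y k - z k‖ ≤ (C + D) * (1 / 2) ^ n := by
    intro n
    induction n with
    | zero =>
      intro k _
      simpa using (norm_sub_le _ _).trans (add_le_add (hC k) (hD k))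
    | succ n ih =>
      intro k hk
      rw [hd, norm_mul, pow_succ, ← mul_assoc, mul_comm]
      exact mul_le_mul (ih _ (by lia)) (hK k hk) (norm_nonneg _) ((norm_nonneg _).trans
        (ih (k + 1) (by lia)))
  have hK0 : y K - z K = 0 := by
    have : Tendsto (fun n : ℕ => (C + D) * (1 / 2 : ℝ) ^ n) atTop (𝓝 ((C + D) * 0)) :=
      (tendsto_pow_atTop_nhds_zero_of_lt_one (by norm_num) (by norm_num)).const_mul _
    rw [mul_zero] at this
    exact norm_le_zero_iff.1 (ge_of_tendsto' this fun n => hb n K le_rfl)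
  have : ∀ k, k ≤ K → y k - z k = 0 := fun k hk =>
    Nat.decreasingInduction (motive := fun k _ => y k - z k = 0)
      (fun k _ ih => by rw [hd, ih, mul_zero]) hK0 hk
  exact sub_eq_zero.1 (this 0 (Nat.zero_le _))

/-! ### Geometric bounds and q-Pochhammer symbols. -/

theorem summable_mul_pow_of_norm_le {c : ℕ → ℂ} {x : ℂ} {C : ℝ} (hc : ∀ n, ‖c n‖ ≤ C)
    (hx : ‖x‖ < 1) : Summable fun n => c n * x ^ n := by
  refine .of_norm_bounded ((summable_geometric_of_lt_one (norm_nonneg _) hx).mul_left C) fun n => ?_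
  rw [norm_mul, norm_pow]
  gcongr
  exact hc n

theorem norm_tsum_le_of_norm_le_mul_pow {f : ℕ → ℂ} {r C : ℝ} (h0 : 0 ≤ r) (h1 : r < 1)
    (hf : ∀ n, ‖f n‖ ≤ C * r ^ n) : ‖∑' n, f n‖ ≤ C * (1 - r)⁻¹ :=
  tsum_of_norm_bounded ((hasSum_geometric_of_lt_one h0 h1).mul_left C) hf

theorem one_sub_ne_zero_of_norm_lt_one {z : ℂ} (hz : ‖z‖ < 1) : 1 - z ≠ 0 := by
  intro h
  rw [← sub_eq_zero.1 h] at hz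
  simp at hz

theorem one_add_ne_zero_of_norm_lt_one {z : ℂ} (hz : ‖z‖ < 1) : 1 + z ≠ 0 := by
  simpa using one_sub_ne_zero_of_norm_lt_one (z := -z) (by simpa using hz)

theorem norm_pow_lt_one {q : ℂ} (hq : ‖q‖ < 1) {n : ℕ} (hn : n ≠ 0) : ‖q ^ n‖ < 1 := by
  rw [norm_pow]
  exact pow_lt_one₀ (norm_nonneg _) hq hn

/-- The finite `q`-Pochhammer symbol `(a; q)ₙ`. -/
noncomputable def qPoch (a q : ℂ) (n : ℕ) : ℂ := ∏ i ∈ Finset.range n, (1 - a * q ^ i)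

@[simp] theorem qPoch_zero (a q : ℂ) : qPoch a q 0 = 1 := by simp [qPoch]

theorem qPoch_succ (a q : ℂ) (n : ℕ) : qPoch a q (n + 1) = qPoch a q n * (1 - a * q ^ n) :=
  Finset.prod_range_succ _ _

theorem norm_mul_pow_lt_one {a q : ℂ} (ha : ‖a‖ < 1) (hq : ‖q‖ < 1) (n : ℕ) :
    ‖a * q ^ n‖ < 1 := by
  rw [norm_mul, norm_pow]
  exact mul_lt_one_of_nonneg_of_lt_one_left (norm_nonneg _) ha
    (pow_le_one₀ (norm_nonneg _) hq.le)

theorem qPoch_ne_zero {a q : ℂ} (ha : ‖a‖ < 1) (hq : ‖q‖ < 1) (n : ℕ) : qPoch a q n ≠ 0 :=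
  Finset.prod_ne_zero_iff.2 fun i _ =>
    one_sub_ne_zero_of_norm_lt_one (norm_mul_pow_lt_one ha hq i)

/-- The nonvanishing of the infinite product is what later bounds the reciprocals of the symbols,
not only the symbols. -/
theorem exists_tendsto_qPoch {a q : ℂ} (ha : ‖a‖ < 1) (hq : ‖q‖ < 1) :
    ∃ L, L ≠ 0 ∧ Tendsto (qPoch a q) atTop (𝓝 L) := by
  have hs : Summable fun i : ℕ => ‖-(a * q ^ i)‖ := by
    simp only [norm_neg, norm_mul, norm_pow]
    exact (summable_geometric_of_lt_one (norm_nonneg _) hq).mul_left _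
  refine ⟨∏' i : ℕ, (1 + -(a * q ^ i)), tprod_one_add_ne_zero_of_summable (fun i => ?_) hs, ?_⟩
  · rw [← sub_eq_add_neg]
    exact one_sub_ne_zero_of_norm_lt_one (norm_mul_pow_lt_one ha hq i)
  · refine (multipliable_one_add_of_summable hs).hasProd.tendsto_prod_nat.congr fun n => ?_
    simp only [qPoch, sub_eq_add_neg]

theorem exists_norm_le_of_tendsto {f : ℕ → ℂ} {L : ℂ} (h : Tendsto f atTop (𝓝 L)) :
    ∃ C, ∀ n, ‖f n‖ ≤ C := by
  obtain ⟨C, hC⟩ := (Metric.isBounded_range_of_tendsto f h).exists_norm_le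
  exact ⟨C, fun n => hC _ ⟨n, rfl⟩⟩

theorem exists_norm_qPoch_le {a q : ℂ} (ha : ‖a‖ < 1) (hq : ‖q‖ < 1) :
    ∃ C, ∀ n, ‖qPoch a q n‖ ≤ C := by
  obtain ⟨L, -, h⟩ := exists_tendsto_qPoch ha hq
  exact exists_norm_le_of_tendsto h

theorem exists_norm_inv_qPoch_le {a q : ℂ} (ha : ‖a‖ < 1) (hq : ‖q‖ < 1) :
    ∃ C, ∀ n, ‖(qPoch a q n)⁻¹‖ ≤ C := by
  obtain ⟨L, hL, h⟩ := exists_tendsto_qPoch ha hq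
  exact exists_norm_le_of_tendsto (h.inv₀ hL)

/-- The ratios of two values of a `q`-Pochhammer symbol are uniformly bounded. -/
theorem exists_norm_qPoch_div_le {a q : ℂ} (ha : ‖a‖ < 1) (hq : ‖q‖ < 1) :
    ∃ C, ∀ m n, ‖qPoch a q m / qPoch a q n‖ ≤ C := by
  obtain ⟨C, hC⟩ := exists_norm_qPoch_le ha hq
  obtain ⟨D, hD⟩ := exists_norm_inv_qPoch_le ha hq
  refine ⟨C * D, fun m n => ?_⟩
  rw [div_eq_mul_inv, norm_mul]
  exact mul_le_mul (hC m) (hD n) (norm_nonneg _) ((norm_nonneg _).trans (hC 0))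

/-! ### Contiguous relations and the tails of the continued fraction. -/

/-- The coefficient `(q²; q²)ₘ₊ₖ / ((-q²; q²)ₘ₊ₖ (q²; q²)ₘ)`. -/
noncomputable def tailCoeff (q : ℂ) (k m : ℕ) : ℂ :=
  qPoch (q ^ 2) (q ^ 2) (m + k) / (qPoch (-q ^ 2) (q ^ 2) (m + k) * qPoch (q ^ 2) (q ^ 2) m)

/-- The series `∑ₘ (q²; q²)ₘ₊ₖ (-x)ᵐ / ((-q²; q²)ₘ₊ₖ (q²; q²)ₘ)`, of which the tails of the
continued fraction are multiples. -/
noncomputable def tailSeries (q : ℂ) (k : ℕ) (x : ℂ) : ℂ := ∑' m, tailCoeff q k m * (-x) ^ m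

section

variable {q : ℂ}

theorem norm_neg_sq_lt_one (hq : ‖q‖ < 1) : ‖-q ^ 2‖ < 1 := by
  rw [norm_neg]
  exact norm_pow_lt_one hq two_ne_zero

theorem exists_norm_tailCoeff_le (hq : ‖q‖ < 1) : ∃ C, ∀ k m, ‖tailCoeff q k m‖ ≤ C := by
  have h2 := norm_pow_lt_one hq two_ne_zero
  obtain ⟨C, hC⟩ := exists_norm_qPoch_div_le h2 h2
  obtain ⟨D, hD⟩ := exists_norm_inv_qPoch_le (norm_neg_sq_lt_one hq) h2
  refine ⟨C * D, fun k m => ?_⟩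
  have : tailCoeff q k m = qPoch (q ^ 2) (q ^ 2) (m + k) / qPoch (q ^ 2) (q ^ 2) m *
      (qPoch (-q ^ 2) (q ^ 2) (m + k))⁻¹ := by
    rw [tailCoeff, mul_comm (qPoch (-q ^ 2) _ _), ← div_div, div_eq_mul_inv (_ / _)]
  rw [this, norm_mul]
  exact mul_le_mul (hC _ _) (hD _) (norm_nonneg _) ((norm_nonneg _).trans (hC 0 0))

theorem summable_tailSeries (hq : ‖q‖ < 1) (k : ℕ) {x : ℂ} (hx : ‖x‖ < 1) :
    Summable fun m => tailCoeff q k m * (-x) ^ m := by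
  obtain ⟨C, hC⟩ := exists_norm_tailCoeff_le hq
  exact summable_mul_pow_of_norm_le (hC k) (by rwa [norm_neg])

theorem exists_norm_tailSeries_le (hq : ‖q‖ < 1) :
    ∃ C, ∀ k x, ‖x‖ ≤ ‖q‖ → ‖tailSeries q k x‖ ≤ C := by
  obtain ⟨C, hC⟩ := exists_norm_tailCoeff_le hq
  refine ⟨C * (1 - ‖q‖)⁻¹, fun k x hx =>
    norm_tsum_le_of_norm_le_mul_pow (norm_nonneg q) hq fun m => ?_⟩
  rw [norm_mul, norm_pow, norm_neg]
  have := (norm_nonneg _).trans (hC 0 0)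
  gcongr
  exact hC k m

theorem one_sub_sq_mul_pow_ne_zero (hq : ‖q‖ < 1) (n : ℕ) : 1 - q ^ 2 * (q ^ 2) ^ n ≠ 0 :=
  one_sub_ne_zero_of_norm_lt_one
    (norm_mul_pow_lt_one (norm_pow_lt_one hq two_ne_zero) (norm_pow_lt_one hq two_ne_zero) n)

theorem one_add_sq_mul_pow_ne_zero (hq : ‖q‖ < 1) (n : ℕ) : 1 + q ^ 2 * (q ^ 2) ^ n ≠ 0 :=
  one_add_ne_zero_of_norm_lt_one
    (norm_mul_pow_lt_one (norm_pow_lt_one hq two_ne_zero) (norm_pow_lt_one hq two_ne_zero) n)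

theorem tailCoeff_succ_right (hq : ‖q‖ < 1) (k m : ℕ) :
    tailCoeff q k (m + 1) * (1 - (q ^ 2) ^ (m + 1)) = tailCoeff q (k + 1) m := by
  have h2 := norm_pow_lt_one hq two_ne_zero
  have h3 := one_sub_sq_mul_pow_ne_zero hq m
  have h4 := qPoch_ne_zero h2 h2 m
  have h5 := qPoch_ne_zero (norm_neg_sq_lt_one hq) h2 (m + 1 + k)
  have e : m + (k + 1) = m + 1 + k := by ring
  rw [tailCoeff, tailCoeff, e, qPoch_succ _ _ m, pow_succ' (q ^ 2) m]
  field_simp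

theorem tailCoeff_succ_left (hq : ‖q‖ < 1) (k m : ℕ) :
    tailCoeff q (k + 1) m * (1 + (q ^ 2) ^ (m + k + 1)) =
      tailCoeff q k m * (1 - (q ^ 2) ^ (m + k + 1)) := by
  have h2 := norm_pow_lt_one hq two_ne_zero
  have h3 := one_add_sq_mul_pow_ne_zero hq (m + k)
  have h4 := qPoch_ne_zero h2 h2 m
  have h5 := qPoch_ne_zero (norm_neg_sq_lt_one hq) h2 (m + k)
  rw [tailCoeff, tailCoeff, ← add_assoc, qPoch_succ, qPoch_succ, pow_succ' (q ^ 2) (m + k),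
    neg_mul, sub_neg_eq_add]
  field_simp

theorem norm_mul_sq_lt_one (hq : ‖q‖ < 1) {x : ℂ} (hx : ‖x‖ < 1) : ‖x * q ^ 2‖ < 1 := by
  simpa using norm_mul_pow_lt_one hx hq 2

/-- Replacing `x` by `x * q ^ 2` scales the `m`-th term by `q ^ (2 * m)`; the factor `1 - q ^ (2 *
m)` kills the constant term and cancels the last factor of `(q²; q²)ₘ`. -/
theorem tailSeries_sub_tailSeries_mul_sq (hq : ‖q‖ < 1) (k : ℕ) {x : ℂ} (hx : ‖x‖ < 1) :
    tailSeries q k x - tailSeries q k (x * q ^ 2) = -x * tailSeries q (k + 1) x := by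
  have s1 := summable_tailSeries hq k hx
  have s2 := summable_tailSeries hq k (norm_mul_sq_lt_one hq hx)
  rw [tailSeries, tailSeries, tailSeries, ← s1.tsum_sub s2, (s1.sub s2).tsum_eq_zero_add,
    ← tsum_mul_left]
  simp only [pow_zero, mul_one, sub_self, zero_add]
  refine tsum_congr fun m => ?_
  rw [← tailCoeff_succ_right hq, ← neg_mul, mul_pow]
  ring

theorem tailSeries_sub_tailSeries_succ (hq : ‖q‖ < 1) (k : ℕ) {x : ℂ} (hx : ‖x‖ < 1) :
    tailSeries q k x - tailSeries q (k + 1) x =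
      q ^ (2 * k + 2) * (tailSeries q k (x * q ^ 2) + tailSeries q (k + 1) (x * q ^ 2)) := by
  have hx' := norm_mul_sq_lt_one hq hx
  rw [tailSeries, tailSeries, tailSeries, tailSeries,
    ← (summable_tailSeries hq k hx).tsum_sub (summable_tailSeries hq (k + 1) hx),
    ← (summable_tailSeries hq k hx').tsum_add (summable_tailSeries hq (k + 1) hx'),
    ← tsum_mul_left]
  refine tsum_congr fun m => ?_
  rw [← neg_mul, mul_pow]
  linear_combination (-(-x) ^ m) * tailCoeff_succ_left hq k m

theorem tailSeries_zero_eq (hq : ‖q‖ < 1) (x : ℂ) :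
    tailSeries q 0 x = ∑' m, (-x) ^ m / qPoch (-q ^ 2) (q ^ 2) m := by
  refine tsum_congr fun m => ?_
  have h2 := norm_pow_lt_one hq two_ne_zero
  have h4 := qPoch_ne_zero h2 h2 m
  have h5 := qPoch_ne_zero (norm_neg_sq_lt_one hq) h2 m
  rw [tailCoeff, add_zero]
  field_simp

/-- For `k = 0` the factor `1 + q ^ (2 * m)` cancels the last factor of `(-q²; q²)ₘ`, shifting the
series; the unshifted term `m = 0` contributes the 2. -/
theorem tailSeries_zero_add (hq : ‖q‖ < 1) {x : ℂ} (hx : ‖x‖ < 1) :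
    tailSeries q 0 x + tailSeries q 0 (x * q ^ 2) = 2 - x * tailSeries q 0 x := by
  have s1 := summable_tailSeries hq 0 hx
  have s2 := summable_tailSeries hq 0 (norm_mul_sq_lt_one hq hx)
  have h2 := norm_pow_lt_one hq two_ne_zero
  have h0 : tailCoeff q 0 0 = 1 := by simp [tailCoeff]
  have key : ∀ m, tailCoeff q 0 (m + 1) * (1 + (q ^ 2) ^ (m + 1)) = tailCoeff q 0 m := fun m => by
    have h3 := one_sub_sq_mul_pow_ne_zero hq m
    have h4 := qPoch_ne_zero h2 h2 m
    have h5 := qPoch_ne_zero (norm_neg_sq_lt_one hq) h2 m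
    have h6 := one_add_sq_mul_pow_ne_zero hq m
    simp only [tailCoeff, add_zero, qPoch_succ, pow_succ' (q ^ 2) m, neg_mul, sub_neg_eq_add]
    field_simp
  have e : -(x * tailSeries q 0 x) = ∑' m, -x * (tailCoeff q 0 m * (-x) ^ m) := by
    rw [tsum_mul_left, tailSeries, neg_mul]
  rw [sub_eq_add_neg, e, tailSeries, tailSeries, ← s1.tsum_add s2, (s1.add s2).tsum_eq_zero_add]
  congr 1
  · simp only [pow_zero, mul_one, h0]
    norm_num
  · refine tsum_congr fun m => ?_
    rw [← key m, ← neg_mul, mul_pow]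
    ring

/-- A bounded solution of the backward recurrence attached to the continued fraction. -/
noncomputable def tailSolution (q : ℂ) : ℕ → ℂ
  | 0 => 1
  | n + 1 => tailSeries q ((n + 1) / 2) (q ^ (2 * (n / 2) + 1)) /
      (2 * qPoch (-q) (q ^ 2) (n / 2) * qPoch (q ^ 2) (q ^ 2) ((n + 1) / 2))

theorem tailSolution_two_mul_add_one (j : ℕ) :
    tailSolution q (2 * j + 1) = tailSeries q j (q ^ (2 * j + 1)) /
      (2 * qPoch (-q) (q ^ 2) j * qPoch (q ^ 2) (q ^ 2) j) := by
  have h1 : (2 * j + 1) / 2 = j := by lia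
  have h2 : 2 * j / 2 = j := by lia
  rw [tailSolution, h1, h2]

theorem tailSolution_two_mul_add_two (j : ℕ) :
    tailSolution q (2 * j + 2) = tailSeries q (j + 1) (q ^ (2 * j + 1)) /
      (2 * qPoch (-q) (q ^ 2) j * qPoch (q ^ 2) (q ^ 2) (j + 1)) := by
  have h1 : (2 * j + 1) / 2 = j := by lia
  have h2 : (2 * j + 1 + 1) / 2 = j + 1 := by lia
  rw [tailSolution, h1, h2]

theorem exists_norm_tailSolution_le (hq : ‖q‖ < 1) : ∃ C, ∀ n, ‖tailSolution q n‖ ≤ C := by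
  have h2 := norm_pow_lt_one hq two_ne_zero
  obtain ⟨C, hC⟩ := exists_norm_tailSeries_le hq
  obtain ⟨D, hD⟩ := exists_norm_inv_qPoch_le (a := -q) (by rwa [norm_neg]) h2
  obtain ⟨E, hE⟩ := exists_norm_inv_qPoch_le h2 h2
  refine ⟨max 1 (C * (2⁻¹ * D * E)), fun n => ?_⟩
  cases n with
  | zero => simp [tailSolution]
  | succ n =>
    refine le_max_of_le_right ?_
    have hD0 := (norm_nonneg _).trans (hD 0)
    rw [tailSolution, div_eq_mul_inv, mul_inv, mul_inv, norm_mul, norm_mul, norm_mul]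
    have h1 : ‖tailSeries q ((n + 1) / 2) (q ^ (2 * (n / 2) + 1))‖ ≤ C := by
      refine hC _ _ ?_
      rw [norm_pow]
      exact pow_le_of_le_one (norm_nonneg _) hq.le (by simp)
    refine mul_le_mul h1 (mul_le_mul (mul_le_mul (by simp) (hD _) (norm_nonneg _) (by norm_num))
      (hE _) (norm_nonneg _) (by positivity)) (by positivity) ((norm_nonneg _).trans h1)

theorem partialNum_two_mul_add_one (j : ℕ) :
    partialNum q (2 * j + 1) = q ^ (4 * j + 1) - q ^ (6 * j + 3) := by
  have h2 : 2 * j / 2 = j := by lia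
  rw [partialNum, if_pos (even_two_mul j), h2]

theorem partialNum_two_mul_add_two (j : ℕ) :
    partialNum q (2 * j + 2) = q ^ (2 * j + 2) + q ^ (4 * j + 3) := by
  have h2 : (2 * j + 1) / 2 = j := by lia
  rw [partialNum, if_neg (by simp), h2]

theorem tailSolution_recurrence (hq : ‖q‖ < 1) (n : ℕ) :
    tailSolution q n = partialDen q n * tailSolution q (n + 1) +
      partialNum q (n + 1) * tailSolution q (n + 2) := by
  have h2 := norm_pow_lt_one hq two_ne_zero
  have hO : ∀ j, qPoch (-q) (q ^ 2) j ≠ 0 := qPoch_ne_zero (by rwa [norm_neg]) h2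
  have hN : ∀ j, qPoch (q ^ 2) (q ^ 2) j ≠ 0 := qPoch_ne_zero h2 h2
  have hx : ∀ j, ‖q ^ (2 * j + 1)‖ < 1 := fun j => norm_pow_lt_one hq (by simp)
  have hO1 : ∀ j, 1 + q * (q ^ 2) ^ j ≠ 0 := fun j =>
    one_add_ne_zero_of_norm_lt_one (norm_mul_pow_lt_one hq h2 j)
  have hN1 := one_sub_sq_mul_pow_ne_zero hq
  have hxs : ∀ j, q ^ (2 * (j + 1) + 1) = q ^ (2 * j + 1) * q ^ 2 := fun j => by ring
  rcases n with _ | n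
  · have e1 := tailSolution_two_mul_add_one (q := q) 0
    have e2 := tailSolution_two_mul_add_two (q := q) 0
    have e3 := partialNum_two_mul_add_one (q := q) 0
    have hA := tailSeries_sub_tailSeries_mul_sq hq 0 hq
    have hC := tailSeries_zero_add hq hq
    have h1 := hN1 0
    simp only [mul_zero, zero_add, pow_one, qPoch_succ, qPoch_zero, mul_one, one_mul, pow_zero]
      at e1 e2 e3 hA h1
    rw [zero_add, zero_add, e1, e2, e3, tailSolution, partialDen]
    field_simp
    -- The sum of the two relations eliminates the series at `q ^ 3`; the inhomogeneous 2 matches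
    -- the normalisation `V 0 = 1`.
    linear_combination -hC - hA
  · obtain ⟨j, rfl | rfl⟩ := Nat.even_or_odd' n
    · have e3 := tailSolution_two_mul_add_one (q := q) (j + 1)
      have hA := tailSeries_sub_tailSeries_mul_sq hq j (hx j)
      have hB := tailSeries_sub_tailSeries_succ hq j (hx j)
      have := hO j; have := hN j; have h3 := hO1 j; have h4 := hN1 j
      rw [show 2 * j + 1 + 2 = 2 * (j + 1) + 1 by ring, e3, tailSolution_two_mul_add_one,
        tailSolution_two_mul_add_two, partialNum_two_mul_add_two, partialDen, hxs, qPoch_succ,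
        qPoch_succ, neg_mul, sub_neg_eq_add]
      -- The second factor cancels the one gained by `(-q; q²)ⱼ₊₁`.
      have e : q ^ (2 * j + 2) + q ^ (4 * j + 3) =
        q ^ (2 * j + 2) * (1 + q * (q ^ 2) ^ j) := by ring
      rw [e]
      field_simp
      -- This combination eliminates the index-`j` series at `q ^ (2 * j + 3)`.
      linear_combination hB - q ^ (2 * j + 2) * hA
    · have e3 := tailSolution_two_mul_add_one (q := q) (j + 1)
      have e4 := tailSolution_two_mul_add_two (q := q) (j + 1)
      have hA := tailSeries_sub_tailSeries_mul_sq hq (j + 1) (hx j)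
      have hB := tailSeries_sub_tailSeries_succ hq (j + 1) (hx j)
      have := hO j; have := hN (j + 1); have h3 := hO1 j; have h4 := hN1 (j + 1)
      rw [show 2 * j + 1 + 1 + 1 = 2 * (j + 1) + 1 by ring,
        show 2 * j + 1 + 1 + 2 = 2 * (j + 1) + 2 by ring, e3, e4, tailSolution_two_mul_add_two,
        partialNum_two_mul_add_one, partialDen, hxs, qPoch_succ (-q), qPoch_succ _ _ (j + 1),
        neg_mul, sub_neg_eq_add]
      have e : q ^ (4 * (j + 1) + 1) - q ^ (6 * (j + 1) + 3) =
        q ^ (4 * j + 5) * (1 - q ^ 2 * (q ^ 2) ^ (j + 1)) := by ring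
      rw [e]
      field_simp
      -- This one eliminates the index-`j + 2` series at `q ^ (2 * j + 1)`.
      linear_combination hA + q ^ (2 * j + 1) * hB

end

/-! ### Fine's series, Rogers' series and the false theta series. -/

theorem triangular_succ (n : ℕ) : (n + 1) * (n + 1 + 1) / 2 = n * (n + 1) / 2 + n + 1 := by
  rw [show (n + 1) * (n + 1 + 1) = n * (n + 1) + (n + 1) * 2 by ring,
    Nat.add_mul_div_right _ _ two_pos, add_assoc]

theorem le_triangular (n : ℕ) : n ≤ n * (n + 1) / 2 := by
  rw [Nat.le_div_iff_mul_le two_pos]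
  nlinarith [Nat.le_mul_self n]

theorem pentagonal_succ (n : ℕ) :
    (n + 1) * (3 * (n + 1) + 1) / 2 = n * (3 * n + 1) / 2 + 3 * n + 2 := by
  rw [show (n + 1) * (3 * (n + 1) + 1) = n * (3 * n + 1) + (3 * n + 2) * 2 by ring,
    Nat.add_mul_div_right _ _ two_pos, add_assoc]

theorem succ_mul_three_mul_succ_sub_one_div_two (n : ℕ) :
    (n + 1) * (3 * (n + 1) - 1) / 2 = n * (3 * n + 1) / 2 + 2 * n + 1 := by
  rw [show 3 * (n + 1) - 1 = 3 * n + 2 by lia,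
    show (n + 1) * (3 * n + 2) = n * (3 * n + 1) + (2 * n + 1) * 2 by ring,
    Nat.add_mul_div_right _ _ two_pos, add_assoc]

theorem le_pentagonal (n : ℕ) : n ≤ n * (3 * n + 1) / 2 := by
  rw [Nat.le_div_iff_mul_le two_pos]
  nlinarith [Nat.le_mul_self n]

/-- The term `(-1)ⁿ q^(n(n+1)/2 + ln) / (-q^(k+1); q)ₙ`. -/
noncomputable def rogersTerm (q : ℂ) (k l n : ℕ) : ℂ :=
  (-1) ^ n * q ^ (n * (n + 1) / 2 + l * n) * (qPoch (-q) q k / qPoch (-q) q (n + k))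

/-- The series `∑ₙ (-1)ⁿ q^(n(n+1)/2 + ln) / (-q^(k+1); q)ₙ`. -/
noncomputable def rogersSeries (q : ℂ) (k l : ℕ) : ℂ := ∑' n, rogersTerm q k l n

/-- The term `(-q^(2k+1))ⁿ / (-q^(2k+2); q²)ₙ`. -/
noncomputable def fineTerm (q : ℂ) (k n : ℕ) : ℂ :=
  (-q ^ (2 * k + 1)) ^ n * (qPoch (-q ^ 2) (q ^ 2) k / qPoch (-q ^ 2) (q ^ 2) (n + k))

/-- The series `∑ₙ (-q^(2k+1))ⁿ / (-q^(2k+2); q²)ₙ`. -/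
noncomputable def fineSeries (q : ℂ) (k : ℕ) : ℂ := ∑' n, fineTerm q k n

/-- The term `q^(n(3n+1)/2 + 3kn) (1 - q^(2n+2k+1))`. -/
noncomputable def falseThetaTerm (q : ℂ) (k n : ℕ) : ℂ :=
  q ^ (n * (3 * n + 1) / 2 + 3 * k * n) * (1 - q ^ (2 * n + 2 * k + 1))

/-- The false theta series `∑ₙ q^(n(3n+1)/2 + 3kn) (1 - q^(2n+2k+1))`. -/
noncomputable def falseTheta (q : ℂ) (k : ℕ) : ℂ := ∑' n, falseThetaTerm q k n

section

variable {q : ℂ}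

theorem summable_of_norm_le_mul_pow (hq : ‖q‖ < 1) {f : ℕ → ℂ} {C : ℝ}
    (hf : ∀ n, ‖f n‖ ≤ C * ‖q‖ ^ n) : Summable f :=
  .of_norm_bounded ((summable_geometric_of_lt_one (norm_nonneg _) hq).mul_left C) hf

theorem norm_pow_le_norm_pow (hq : ‖q‖ < 1) {m n : ℕ} (h : m ≤ n) : ‖q ^ n‖ ≤ ‖q‖ ^ m := by
  rw [norm_pow]
  exact pow_le_pow_of_le_one (norm_nonneg _) hq.le h

theorem exists_norm_rogersTerm_le (hq : ‖q‖ < 1) :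
    ∃ C, ∀ k l n, ‖rogersTerm q k l n‖ ≤ C * ‖q‖ ^ n := by
  obtain ⟨C, hC⟩ := exists_norm_qPoch_div_le (a := -q) (by rwa [norm_neg]) hq
  refine ⟨C, fun k l n => ?_⟩
  rw [rogersTerm, norm_mul, norm_mul, norm_pow, norm_neg, norm_one, one_pow, one_mul, mul_comm]
  exact mul_le_mul (hC _ _) (norm_pow_le_norm_pow hq ((le_triangular n).trans (by simp)))
    (norm_nonneg _) ((norm_nonneg _).trans (hC 0 0))

theorem exists_norm_fineTerm_le (hq : ‖q‖ < 1) :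
    ∃ C, ∀ k n, ‖fineTerm q k n‖ ≤ C * ‖q‖ ^ n := by
  obtain ⟨C, hC⟩ :=
    exists_norm_qPoch_div_le (norm_neg_sq_lt_one hq) (norm_pow_lt_one hq two_ne_zero)
  refine ⟨C, fun k n => ?_⟩
  rw [fineTerm, norm_mul, mul_comm, norm_pow, norm_neg]
  refine mul_le_mul (hC _ _) ?_ (by positivity) ((norm_nonneg _).trans (hC 0 0))
  gcongr
  simpa using norm_pow_le_norm_pow hq (show 1 ≤ 2 * k + 1 by simp)

theorem norm_falseThetaTerm_le (hq : ‖q‖ < 1) (k n : ℕ) :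
    ‖falseThetaTerm q k n‖ ≤ 2 * ‖q‖ ^ n := by
  rw [falseThetaTerm, norm_mul, mul_comm]
  refine mul_le_mul ?_ (norm_pow_le_norm_pow hq ((le_pentagonal n).trans (by simp)))
    (norm_nonneg _) zero_le_two
  refine (norm_sub_le _ _).trans ?_
  have := (norm_pow_lt_one hq (n := 2 * n + 2 * k + 1) (by simp)).le
  rw [norm_one]
  linarith

theorem summable_rogersTerm (hq : ‖q‖ < 1) (k l : ℕ) : Summable (rogersTerm q k l) := by
  obtain ⟨C, hC⟩ := exists_norm_rogersTerm_le hq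
  exact summable_of_norm_le_mul_pow hq (hC k l)

theorem summable_fineTerm (hq : ‖q‖ < 1) (k : ℕ) : Summable (fineTerm q k) := by
  obtain ⟨C, hC⟩ := exists_norm_fineTerm_le hq
  exact summable_of_norm_le_mul_pow hq (hC k)

theorem summable_falseThetaTerm (hq : ‖q‖ < 1) (k : ℕ) : Summable (falseThetaTerm q k) :=
  summable_of_norm_le_mul_pow hq (norm_falseThetaTerm_le hq k)

theorem exists_norm_rogersSeries_le (hq : ‖q‖ < 1) : ∃ C, ∀ k l, ‖rogersSeries q k l‖ ≤ C := by
  obtain ⟨C, hC⟩ := exists_norm_rogersTerm_le hq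
  exact ⟨_, fun k l => norm_tsum_le_of_norm_le_mul_pow (norm_nonneg q) hq (hC k l)⟩

theorem exists_norm_fineSeries_le (hq : ‖q‖ < 1) : ∃ C, ∀ k, ‖fineSeries q k‖ ≤ C := by
  obtain ⟨C, hC⟩ := exists_norm_fineTerm_le hq
  exact ⟨_, fun k => norm_tsum_le_of_norm_le_mul_pow (norm_nonneg q) hq (hC k)⟩

theorem exists_norm_falseTheta_le (hq : ‖q‖ < 1) : ∃ C, ∀ k, ‖falseTheta q k‖ ≤ C :=
  ⟨_, fun k => norm_tsum_le_of_norm_le_mul_pow (norm_nonneg q) hq (norm_falseThetaTerm_le hq k)⟩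

theorem qPoch_neg_ne_zero (hq : ‖q‖ < 1) (n : ℕ) : qPoch (-q) q n ≠ 0 :=
  qPoch_ne_zero (by rwa [norm_neg]) hq n

theorem qPoch_neg_succ (q : ℂ) (n : ℕ) :
    qPoch (-q) q (n + 1) = qPoch (-q) q n * (1 + q ^ (n + 1)) := by
  rw [qPoch_succ, neg_mul, sub_neg_eq_add, pow_succ']

theorem one_add_pow_succ_ne_zero (hq : ‖q‖ < 1) (n : ℕ) : 1 + q ^ (n + 1) ≠ 0 :=
  one_add_ne_zero_of_norm_lt_one (norm_pow_lt_one hq (by simp))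

theorem rogersTerm_zero (hq : ‖q‖ < 1) (k l : ℕ) : rogersTerm q k l 0 = 1 := by
  simp [rogersTerm, qPoch_neg_ne_zero hq k]

theorem rogersSeries_diag (hq : ‖q‖ < 1) (j : ℕ) :
    rogersSeries q j j =
      1 - q ^ (j + 1) / (1 + q ^ (j + 1)) * rogersSeries q (j + 1) (j + 1) := by
  rw [rogersSeries, (summable_rogersTerm hq j j).tsum_eq_zero_add, rogersTerm_zero hq,
    rogersSeries, ← tsum_mul_left, sub_eq_add_neg, ← tsum_neg]
  congr 1
  refine tsum_congr fun n => ?_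
  have h1 := one_add_pow_succ_ne_zero hq j
  have h2 := qPoch_neg_ne_zero hq j
  have h3 := qPoch_neg_ne_zero hq (n + (j + 1))
  rw [rogersTerm, rogersTerm, triangular_succ, show n + 1 + j = n + (j + 1) by ring,
    qPoch_neg_succ q j]
  field_simp
  ring

theorem rogersTerm_succ (hq : ‖q‖ < 1) (k n : ℕ) :
    rogersTerm q k (2 * k) (n + 1) * (1 + q ^ (k + n + 1)) =
      -(q ^ (2 * k + n + 1) * rogersTerm q k (2 * k) n) := by
  have h2 := qPoch_neg_ne_zero hq (n + k)
  have h1 := one_add_pow_succ_ne_zero hq (n + k)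
  rw [rogersTerm, rogersTerm, triangular_succ, show n + 1 + k = n + k + 1 by ring,
    show k + n + 1 = n + k + 1 by ring, qPoch_neg_succ]
  field_simp
  ring

theorem rogersTerm_succ_param (hq : ‖q‖ < 1) (k n : ℕ) :
    q ^ (3 * k + 2) * rogersTerm q (k + 1) (2 * (k + 1)) n =
      -(rogersTerm q k (2 * k) (n + 1) * (q ^ (k + n + 1) * (1 + q ^ (k + 1)))) := by
  have h2 := qPoch_neg_ne_zero hq (n + (k + 1))
  rw [rogersTerm, rogersTerm, triangular_succ, show n + 1 + k = n + (k + 1) by ring,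
    qPoch_neg_succ q k]
  field_simp
  ring

/-- After the initial 1, each term is a term of the series for `k + 1` plus a difference `h (n + 1)
- h n`; the telescoping part sums to `-h 0 = -q ^ (2 * k + 1)`. -/
theorem rogersSeries_double (hq : ‖q‖ < 1) (k : ℕ) :
    rogersSeries q k (2 * k) =
      1 - q ^ (2 * k + 1) + q ^ (3 * k + 2) * rogersSeries q (k + 1) (2 * (k + 1)) := by
  obtain ⟨C, hC⟩ := exists_norm_rogersTerm_le hq
  set h : ℕ → ℂ := fun n => q ^ (2 * k + n + 1) * rogersTerm q k (2 * k) n with hh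
  have hs : Summable h := by
    refine summable_of_norm_le_mul_pow hq (C := C) fun n => ?_
    rw [hh, norm_mul]
    exact (mul_le_of_le_one_left (norm_nonneg _)
      (norm_pow_lt_one hq (by simp)).le).trans (hC _ _ _)
  have hs' : Summable fun n => h (n + 1) := (summable_nat_add_iff 1).2 hs
  have he := (summable_rogersTerm hq (k + 1) (2 * (k + 1))).mul_left (q ^ (3 * k + 2))
  have hterm : ∀ n, rogersTerm q k (2 * k) (n + 1) =
      q ^ (3 * k + 2) * rogersTerm q (k + 1) (2 * (k + 1)) n + (h (n + 1) - h n) := fun n => by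
    have h1 := rogersTerm_succ hq k n
    have h2 := rogersTerm_succ_param hq k n
    simp only [hh]
    linear_combination h1 - h2
  have h0 : h 0 = q ^ (2 * k + 1) := by simp [hh, rogersTerm_zero hq]
  rw [rogersSeries, (summable_rogersTerm hq k (2 * k)).tsum_eq_zero_add, rogersTerm_zero hq,
    tsum_congr hterm, he.tsum_add (hs'.sub hs), hs'.tsum_sub hs, hs.tsum_eq_zero_add, h0,
    tsum_mul_left, ← rogersSeries]
  ring

theorem falseTheta_recurrence (hq : ‖q‖ < 1) (k : ℕ) :
    falseTheta q k = 1 - q ^ (2 * k + 1) + q ^ (3 * k + 2) * falseTheta q (k + 1) := by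
  rw [falseTheta, (summable_falseThetaTerm hq k).tsum_eq_zero_add, falseTheta, ← tsum_mul_left]
  congr 1
  · simp [falseThetaTerm]
  · refine tsum_congr fun n => ?_
    rw [falseThetaTerm, falseThetaTerm, pentagonal_succ]
    ring

/-- This is `1 / (1 + y) = 1 - y / (1 + y)` applied to the newest denominator factor, with `y = q ^
(2 * (n + k + 1))`. -/
theorem fineTerm_succ (hq : ‖q‖ < 1) (k n : ℕ) :
    fineTerm q k (n + 1) = -(q ^ (2 * k + 1) * fineTerm q k n) +
      q ^ (4 * k + 3) / (1 + q ^ (2 * k + 1 + 1)) * fineTerm q (k + 1) n := by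
  have h2 := norm_pow_lt_one hq two_ne_zero
  have hQ := qPoch_ne_zero (norm_neg_sq_lt_one hq) h2
  have hs : ∀ n, qPoch (-q ^ 2) (q ^ 2) (n + 1) =
      qPoch (-q ^ 2) (q ^ 2) n * (1 + q ^ (2 * n + 1 + 1)) := fun n => by
    rw [qPoch_succ]; ring
  have h3 := hQ (n + k)
  have h4 := hQ k
  have h5 := one_add_pow_succ_ne_zero hq (2 * k + 1)
  have h6 := one_add_pow_succ_ne_zero hq (2 * (n + k) + 1)
  rw [fineTerm, fineTerm, fineTerm, show n + 1 + k = n + k + 1 by ring, ← add_assoc n k 1, hs, hs]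
  have e : -q ^ (2 * (k + 1) + 1) = -q ^ (2 * k + 1) * q ^ 2 := by ring
  rw [e, mul_pow]
  field_simp
  ring

theorem fineSeries_recurrence (hq : ‖q‖ < 1) (k : ℕ) :
    fineSeries q k = 1 / (1 + q ^ (2 * k + 1)) +
      q ^ (4 * k + 3) / ((1 + q ^ (2 * k + 1)) * (1 + q ^ (2 * k + 1 + 1))) *
        fineSeries q (k + 1) := by
  have h1 := one_add_pow_succ_ne_zero hq (2 * k)
  have h2 := one_add_pow_succ_ne_zero hq (2 * k + 1)
  have h0 : fineTerm q k 0 = 1 := by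
    have := qPoch_ne_zero (norm_neg_sq_lt_one hq) (norm_pow_lt_one hq two_ne_zero) k
    simp [fineTerm, this]
  have s0 := summable_fineTerm hq k
  have s1 := summable_fineTerm hq (k + 1)
  have key : fineSeries q k = 1 + (-(q ^ (2 * k + 1) * fineSeries q k) +
      q ^ (4 * k + 3) / (1 + q ^ (2 * k + 1 + 1)) * fineSeries q (k + 1)) := by
    conv_lhs => rw [fineSeries, s0.tsum_eq_zero_add, h0, tsum_congr (fineTerm_succ hq k),
      (s0.mul_left _).neg.tsum_add (s1.mul_left _), tsum_neg, tsum_mul_left, tsum_mul_left]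
    rfl
  field_simp at key ⊢
  linear_combination key

theorem tendsto_pow_linear (hq : ‖q‖ < 1) {a b : ℕ} (ha : a ≠ 0) :
    Tendsto (fun k => q ^ (a * k + b)) atTop (𝓝 0) := by
  refine (tendsto_pow_atTop_nhds_zero_of_norm_lt_one hq).comp ?_
  exact tendsto_atTop_mono (fun k =>
    (Nat.le_mul_of_pos_left k (Nat.pos_of_ne_zero ha)).trans (Nat.le_add_right _ b)) tendsto_id

theorem rogersSeries_eq_falseTheta (hq : ‖q‖ < 1) : rogersSeries q 0 0 = falseTheta q 0 := by
  obtain ⟨C, hC⟩ := exists_norm_rogersSeries_le hq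
  exact eq_of_bounded_of_backward_recurrence (y := fun k => rogersSeries q k (2 * k))
    (tendsto_pow_linear hq three_ne_zero) ⟨C, fun k => hC _ _⟩ (exists_norm_falseTheta_le hq)
    (rogersSeries_double hq) (falseTheta_recurrence hq)

theorem fineSeries_eq_rogersSeries (hq : ‖q‖ < 1) : fineSeries q 0 = rogersSeries q 0 0 := by
  obtain ⟨C, hC⟩ := exists_norm_rogersSeries_le hq
  refine eq_of_bounded_of_backward_recurrence (z := fun k => rogersSeries q (2 * k) (2 * k))
    ?_ (exists_norm_fineSeries_le hq) ⟨C, fun k => hC _ _⟩ (fineSeries_recurrence hq) fun k => ?_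
  · have h1 := (tendsto_pow_linear hq (a := 2) (b := 1) two_ne_zero).const_add 1
    have h2 := (tendsto_pow_linear hq (a := 2) (b := 1 + 1) two_ne_zero).const_add 1
    have := (tendsto_pow_linear hq (a := 4) (b := 3) four_ne_zero).div (h1.mul h2) (by simp)
    rwa [zero_div] at this
  · have h1 := one_add_pow_succ_ne_zero hq (2 * k)
    have h2 := one_add_pow_succ_ne_zero hq (2 * k + 1)
    -- One step in Fine's parameter corresponds to two steps along the diagonal.
    rw [rogersSeries_diag hq, rogersSeries_diag hq (2 * k + 1), mul_add_one 2 k]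
    field_simp
    ring

theorem summable_pow_pentagonal (hq : ‖q‖ < 1) :
    Summable fun n : ℕ => q ^ (n * (3 * n + 1) / 2) :=
  summable_of_norm_le_mul_pow hq (C := 1) fun n => by
    rw [one_mul]
    exact norm_pow_le_norm_pow hq (le_pentagonal n)

/-- With `u n = q ^ (n * (3 * n + 1) / 2)`, the false theta term is `u n` minus the lower pentagonal
power of index `n + 1`. Removing also `u (n + 1)` leaves the summand, and `∑ u n - ∑ u (n + 1) = 1`.
-/
theorem hasSum_pentagonal (hq : ‖q‖ < 1) :
    HasSum (fun n : ℕ+ => q ^ ((n : ℕ) * (3 * (n : ℕ) - 1) / 2) * (1 - q ^ (n : ℕ)))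
      (1 - falseTheta q 0) := by
  have hu := summable_pow_pentagonal hq
  have hθ := summable_falseThetaTerm hq 0
  have hu1 : HasSum (fun n : ℕ => q ^ ((n + 1) * (3 * (n + 1) + 1) / 2))
      (∑' n : ℕ, q ^ (n * (3 * n + 1) / 2) - 1) := by
    simpa using (hasSum_nat_add_iff' 1).2 hu.hasSum
  have h := (hu.hasSum.sub hθ.hasSum).sub hu1
  rw [← falseTheta, sub_sub_sub_comm, sub_self, zero_sub, neg_sub] at h
  rw [← Equiv.pnatEquivNat.symm.hasSum_iff]
  refine h.congr_fun fun n => ?_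
  rw [Function.comp_apply, Equiv.pnatEquivNat_symm_apply, Nat.succPNat_coe, Nat.succ_eq_add_one,
    succ_mul_three_mul_succ_sub_one_div_two, pentagonal_succ, falseThetaTerm]
  ring

end

/-! ### Assembly of the main theorem. -/

theorem mainTheorem12 (q : ℂ) (hq : ‖q‖ < 1) :
    Summable (fun n : ℕ+ =>
      q ^ ((n : ℕ) * (3 * (n : ℕ) - 1) / 2) * (1 - q ^ (n : ℕ))) ∧
    ContFracConvergesTo (qContFrac q)
      (1 - ∑' n : ℕ+, q ^ ((n : ℕ) * (3 * (n : ℕ) - 1) / 2) * (1 - q ^ (n : ℕ))) := by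
  have hsum := hasSum_pentagonal hq
  refine ⟨hsum.summable, ?_⟩
  rw [hsum.tsum_eq, sub_sub_cancel]
  have hden : Summable fun n => ‖partialDen q n - 1‖ := by
    -- The irregular first entry `2 + q` is dropped; the rest are geometrically close to 1.
    refine (summable_nat_add_iff 1).1 ?_
    refine .of_nonneg_of_le (fun _ => norm_nonneg _) (fun n => ?_)
      (summable_geometric_of_lt_one (norm_nonneg _) hq)
    rw [partialDen, add_sub_cancel_left]
    exact norm_pow_le_norm_pow hq (by lia)
  have hnum : Summable fun n => ‖partialNum q n‖ := by
    refine (summable_nat_add_iff 1).1 ?_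
    refine .of_nonneg_of_le (fun _ => norm_nonneg _) (fun n => ?_)
      ((summable_geometric_of_lt_one (norm_nonneg _) hq).mul_left 2)
    have hle : ∀ m, n ≤ m → ‖q ^ m‖ ≤ ‖q‖ ^ n := fun m => norm_pow_le_norm_pow hq
    rw [partialNum, two_mul (‖q‖ ^ n)]
    split_ifs
    · refine (norm_sub_le _ _).trans (add_le_add (hle _ ?_) (hle _ ?_)) <;> lia
    · refine (norm_add_le _ _).trans (add_le_add (hle _ ?_) (hle _ ?_)) <;> lia
  have h := contFracConvergesTo_of_bounded_tails hnum hden (exists_norm_tailSolution_le hq) rfl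
    (tailSolution_recurrence hq)
  have hval : partialNum q 0 * tailSolution q 1 = falseTheta q 0 := by
    have h1 := tailSolution_two_mul_add_one (q := q) 0
    rw [mul_zero, zero_add, pow_one, qPoch_zero, qPoch_zero, mul_one, mul_one,
      tailSeries_zero_eq hq] at h1
    rw [← rogersSeries_eq_falseTheta hq, ← fineSeries_eq_rogersSeries hq, h1, partialNum,
      mul_div_cancel₀ _ two_ne_zero, fineSeries]
    refine tsum_congr fun n => ?_
    simp [fineTerm, div_eq_mul_inv]
  rwa [hval] at h
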